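/- Let $R$ be a commutative ring with unit, let $\sigma:P^{-1}\to P^{0}$ be a homomorphism between projective $R$-modules, and let $T=\mathrm{Coker}(\sigma)$. For a prime $\mathfrak p\in\mathrm{Spec}(R)$ let $\kappa(\mathfrak p)$ be the field of fractions of $R/\mathfrak p$. Put $$\mathcal D_\sigma=\{X\in\mathrm{Mod}\text{-}R \mid \mathrm{Hom}_R(\sigma,X):\mathrm{Hom}_R(P^0,X)\to\mathrm{Hom}_R(P^{-1},X)\text{ is an epimorphism}\},$$ $$\mathrm{Gen}(T)=\{M\in\mathrm{Mod}\text{-}R\mid \text{there are a set } I \text{ and an epimorphism } T^{(I)}\to M\}.$$ The homomorphism $\sigma$ is called *partial silting* if $\mathcal D_\sigma$ is a torsion class (that is, closed under epimorphic images, extensions and arbitrary direct sums) and $T\in\mathcal D_\sigma$; it is called a *$2$-term silting complex* if $\mathcal D_\sigma=\mathrm{Gen}(T)$. The following are equivalent: 1. $\sigma$ is a $2$-term silting complex; 2. (i) $\sigma$ is partial silting, and (ii) for every $\mathfrak p\in\mathrm{Spec}(R)$ we have $T\otimes_R\kappa(\mathfrak p)\neq 0$ or $\mathrm{Ker}(\sigma\otimes_R\kappa(\mathfrak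 p))\neq 0$. -/

import Mathlib

open scoped TensorProduct DirectSum

universe u

namespace Silting

variable {R : Type u} [CommRing R]

/-- A class of `R`-modules is a torsion class if it is closed under epimorphic images,
extensions and arbitrary direct sums. (It then contains the zero module, the empty direct
sum, and is closed under isomorphisms.) -/
structure IsTorsionClass (C : Set (ModuleCat.{u} R)) : Prop where
  epi : ∀ (M N : ModuleCat.{u} R) (f : M →ₗ[R] N), Function.Surjective f → M ∈ C → N ∈ C
  extension : ∀ (L M N : ModuleCat.{u} R) (f : L →ₗ[R] M) (g : M →ₗ[R] N),
    Function.Injective f → Function.Exact f g → Function.Surjective g →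
    L ∈ C → N ∈ C → M ∈ C
  directSum : ∀ (I : Type u) (M : I → ModuleCat.{u} R), (∀ i, M i ∈ C) →
    ModuleCat.of R (⨁ i, M i) ∈ C

/-- `Gen(T)`: the modules `M` for which there is an epimorphism `T^(I) → M`. -/
def Gen (T : Type u) [AddCommGroup T] [Module R T] : Set (ModuleCat.{u} R) :=
  {M | ∃ (I : Type u) (f : (⨁ _ : I, T) →ₗ[R] M), Function.Surjective f}

variable {P Q : Type u} [AddCommGroup P] [Module R P] [AddCommGroup Q] [Module R Q]

/-- `T = Coker(σ)`. -/
abbrev Coker (σ : P →ₗ[R] Q) : Type u := Q ⧸ LinearMap.range σ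

/-- `D_σ`: the modules `X` for which `Hom_R(σ, X) : Hom_R(Q, X) → Hom_R(P, X)` is an
epimorphism. -/
def DClass (σ : P →ₗ[R] Q) : Set (ModuleCat.{u} R) :=
  {X | Function.Surjective (fun g : Q →ₗ[R] X => g ∘ₗ σ)}

/-- `σ` is partial silting if `D_σ` is a torsion class containing `T = Coker(σ)`. -/
def IsPartialSilting (σ : P →ₗ[R] Q) : Prop :=
  IsTorsionClass (DClass σ) ∧ ModuleCat.of R (Coker σ) ∈ DClass σ

/-- `σ` is a 2-term silting complex if `D_σ = Gen(T)`, where `T = Coker(σ)`. -/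
def IsTwoTermSilting (σ : P →ₗ[R] Q) : Prop :=
  DClass σ = Gen (R := R) (Coker σ)

end Silting

/-! If `σ` is silting, closure under quotients and sums is clear for `Gen(T)`, and under extensions
for `D_σ`, as `Q` is projective. If (ii) failed at `p`, then `σ ⊗ κ(p)` would split, so `κ(p) ∈ D_σ
= Gen(T)`, although `Hom(T, κ(p)) = 0`.

Conversely, partial silting gives `Gen(T) ⊆ D_σ`. For `M ∈ D_σ`, let `X` be `M` modulo the trace of
`T`; then `Hom(σ, X)` is bijective. If `X ≠ 0`, closure properties and Zorn yield a simple object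
among such modules (`HomBijective.exists_simple`). By Schur's argument each scalar acts on it as
zero or bijectively, so it is a vector space over some `κ(p)`, and `κ(p)` is a retract of it. Thus
`Hom(σ, κ(p))` is bijective; dually `σ ⊗ κ(p)` has zero kernel and cokernel, contradicting (ii). -/

namespace Silting

/-! ### Closure properties of bijectivity of `Hom(σ, -)` -/

section HomBijective

variable {R : Type*} [CommRing R] {P Q : Type*} [AddCommGroup P] [Module R P]
  [AddCommGroup Q] [Module R Q]

/-- `Hom_R(σ, X) : Hom_R(Q, X) → Hom_R(P, X)` is bijective. -/
def HomBijective (σ : P →ₗ[R] Q) (X : Type*) [AddCommGroup X] [Module R X] : Prop :=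
  Function.Bijective (fun g : Q →ₗ[R] X => g ∘ₗ σ)

variable {σ : P →ₗ[R] Q} {X : Type*} [AddCommGroup X] [Module R X]
  {Y : Type*} [AddCommGroup Y] [Module R Y]

/-- If `Hom(σ, Y)` is injective, then so is `Hom(σ, X)` for every submodule `X` of `Y`. -/
lemma injective_comp_of_injective {i : X →ₗ[R] Y} (hi : Function.Injective i)
    (hY : Function.Injective (fun g : Q →ₗ[R] Y => g ∘ₗ σ)) :
    Function.Injective (fun g : Q →ₗ[R] X => g ∘ₗ σ) := by
  intro g h hgh
  have : i ∘ₗ g = i ∘ₗ h := hY (by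
    change (i ∘ₗ g) ∘ₗ σ = (i ∘ₗ h) ∘ₗ σ
    rw [LinearMap.comp_assoc, LinearMap.comp_assoc]
    exact congrArg (i ∘ₗ ·) hgh)
  ext q
  exact hi (LinearMap.congr_fun this q)

lemma HomBijective.of_retract (hY : HomBijective σ Y) (i : X →ₗ[R] Y) (p : Y →ₗ[R] X)
    (h : p ∘ₗ i = LinearMap.id) : HomBijective σ X := by
  refine ⟨injective_comp_of_injective (i := i) (fun x y hxy => ?_) hY.1, fun g => ?_⟩
  · have := congrArg p hxy
    rwa [← LinearMap.comp_apply, ← LinearMap.comp_apply, h] at this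
  · obtain ⟨k, hk⟩ := hY.2 (i ∘ₗ g)
    refine ⟨p ∘ₗ k, ?_⟩
    change (p ∘ₗ k) ∘ₗ σ = g
    rw [LinearMap.comp_assoc, show k ∘ₗ σ = i ∘ₗ g from hk, ← LinearMap.comp_assoc, h,
      LinearMap.id_comp]

lemma HomBijective.ker (hX : HomBijective σ X)
    (hY : Function.Injective (fun g : Q →ₗ[R] Y => g ∘ₗ σ)) (f : X →ₗ[R] Y) :
    HomBijective σ (LinearMap.ker f) := by
  refine ⟨injective_comp_of_injective (Submodule.injective_subtype _) hX.1, fun g => ?_⟩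
  obtain ⟨h, hh⟩ := hX.2 ((LinearMap.ker f).subtype ∘ₗ g)
  have h' : ∀ p, h (σ p) = g p := fun p => LinearMap.congr_fun hh p
  have hf : f ∘ₗ h = 0 := hY (by
    ext p
    simp [h'])
  refine ⟨h.codRestrict _ fun q => LinearMap.congr_fun hf q, ?_⟩
  ext p
  exact h' p

/-- Extensions along `σ` into `X` are unique, so the one into `X` agrees with those into each `U`.
-/
lemma HomBijective.sInf_of_forall (hX : HomBijective σ X) {c : Set (Submodule R X)}
    (hc : ∀ U ∈ c, HomBijective σ U) : HomBijective σ (sInf c : Submodule R X) := by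
  refine ⟨injective_comp_of_injective (Submodule.injective_subtype _) hX.1, fun g => ?_⟩
  obtain ⟨h, hh⟩ := hX.2 ((sInf c : Submodule R X).subtype ∘ₗ g)
  have h' : ∀ p, h (σ p) = g p := fun p => LinearMap.congr_fun hh p
  have hmem : ∀ q, h q ∈ (sInf c : Submodule R X) := by
    intro q
    rw [Submodule.mem_sInf]
    intro U hU
    obtain ⟨k, hk⟩ := (hc U hU).2 (Submodule.inclusion (sInf_le hU) ∘ₗ g)
    have : U.subtype ∘ₗ k = h := hX.1 (by
      ext p
      have := congrArg U.subtype (LinearMap.congr_fun hk p)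
      simpa [h'] using this)
    rw [← this]
    exact (k q).2
  refine ⟨h.codRestrict _ hmem, ?_⟩
  ext p
  exact h' p

/-- A lifting argument: `Hom(σ, X ⧸ V)` is injective as soon as all maps `Q → X` that send the
image of `σ` to `0` factor through `V`, and `Hom(σ, V)` is surjective. -/
lemma injective_comp_quotient [Module.Projective R Q] {V : Submodule R X}
    (hV : Function.Surjective (fun g : Q →ₗ[R] V => g ∘ₗ σ))
    (h : ∀ k : Q →ₗ[R] X, k ∘ₗ σ = 0 → ∀ q, k q ∈ V) :
    Function.Injective (fun g : Q →ₗ[R] X ⧸ V => g ∘ₗ σ) := by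
  refine (injective_iff_map_eq_zero (LinearMap.lcomp R (X ⧸ V) σ)).2 ?_
  intro g hg
  obtain ⟨l, hl⟩ := Module.projective_lifting_property V.mkQ g V.mkQ_surjective
  have hlV : ∀ p, l (σ p) ∈ V := by
    intro p
    rw [← Submodule.Quotient.mk_eq_zero, ← Submodule.mkQ_apply, ← LinearMap.comp_apply, hl]
    exact LinearMap.congr_fun hg p
  -- `l - m` kills the image of `σ`, so it lands in `V`, and hence so does `l`.
  obtain ⟨m, hm⟩ := hV ((l ∘ₗ σ).codRestrict V hlV)
  have hk := h (l - V.subtype ∘ₗ m) (by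
    ext p
    have := congrArg V.subtype (LinearMap.congr_fun hm p)
    simp only [LinearMap.comp_apply, Submodule.subtype_apply,
      LinearMap.codRestrict_apply] at this
    simp [this])
  ext q
  rw [← hl, LinearMap.comp_apply, Submodule.mkQ_apply, LinearMap.zero_apply,
    Submodule.Quotient.mk_eq_zero]
  simpa using V.add_mem (hk q) (m q).2

end HomBijective

/-! ### Maps into a field and base change to it -/

section Field

variable {R : Type*} [CommRing R] {P Q : Type*} [AddCommGroup P] [Module R P]
  [AddCommGroup Q] [Module R Q]

lemma surjective_comp_of_ker_rTensor_eq_bot {σ : P →ₗ[R] Q} {K : Type*} [Field K] [Algebra R K]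
    (hker : LinearMap.ker (σ.rTensor K) = ⊥) :
    Function.Surjective (fun g : Q →ₗ[R] K => g ∘ₗ σ) := by
  intro g
  have hinj : LinearMap.ker (σ.baseChange K) = ⊥ := by
    rw [LinearMap.ker_eq_bot] at hker ⊢
    exact (LinearMap.lTensor_inj_iff_rTensor_inj K σ).2 hker
  obtain ⟨r, hr⟩ := LinearMap.exists_leftInverse_of_injective _ hinj
  refine ⟨(g.liftBaseChange K ∘ₗ r).restrictScalars R ∘ₗ TensorProduct.mk R K Q 1, ?_⟩
  ext p
  have := LinearMap.congr_fun hr (1 ⊗ₜ p)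
  simp only [LinearMap.comp_apply, LinearMap.baseChange_tmul, LinearMap.id_apply] at this
  simp [this]

lemma eq_zero_of_subsingleton_tensor {T : Type*} [AddCommGroup T] [Module R T]
    {K : Type*} [Field K] [Algebra R K] (h : Subsingleton (T ⊗[R] K)) (f : T →ₗ[R] K) :
    f = 0 := by
  have : Subsingleton (K ⊗[R] T) := (TensorProduct.comm R K T).toEquiv.subsingleton
  ext t
  rw [← one_smul K (f t), ← LinearMap.liftBaseChange_tmul,
    Subsingleton.elim ((1 : K) ⊗ₜ[R] t) 0, map_zero, LinearMap.zero_apply]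

/-- Functionals separate vectors, and each functional on `K ⊗ P` extends along `σ`. -/
lemma HomBijective.ker_rTensor_eq_bot {σ : P →ₗ[R] Q} {K : Type*} [Field K] [Algebra R K]
    (hK : HomBijective σ K) : LinearMap.ker (σ.rTensor K) = ⊥ := by
  rw [LinearMap.ker_eq_bot, ← LinearMap.lTensor_inj_iff_rTensor_inj]
  change Function.Injective (σ.baseChange K)
  rw [injective_iff_map_eq_zero]
  intro z hz
  rw [← Module.forall_dual_apply_eq_zero_iff K]
  intro φ
  obtain ⟨h, hh⟩ := hK.2 (φ.restrictScalars R ∘ₗ TensorProduct.mk R K P 1)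
  have hφ : φ = h.liftBaseChange K ∘ₗ σ.baseChange K := by
    ext p
    simpa using (LinearMap.congr_fun hh p).symm
  rw [hφ, LinearMap.comp_apply, hz, map_zero]

lemma HomBijective.subsingleton_tensor {σ : P →ₗ[R] Q} {K : Type*} [Field K] [Algebra R K]
    (hK : HomBijective σ K) : Subsingleton ((Q ⧸ LinearMap.range σ) ⊗[R] K) := by
  have : Subsingleton (K ⊗[R] (Q ⧸ LinearMap.range σ)) := by
    refine subsingleton_of_forall_eq 0 fun z => ?_
    rw [← Module.forall_dual_apply_eq_zero_iff K]
    intro φ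
    have h0 : (φ.restrictScalars R ∘ₗ TensorProduct.mk R K _ 1) ∘ₗ
        (LinearMap.range σ).mkQ = 0 := hK.1 (by
      ext p
      have : Submodule.Quotient.mk (p := LinearMap.range σ) (σ p) = 0 := by
        simp
      simp [this])
    have hφ : φ = 0 := by
      ext q
      simpa using LinearMap.congr_fun h0 q
    rw [hφ, LinearMap.zero_apply]
  exact (TensorProduct.comm R _ K).toEquiv.subsingleton

end Field

/-! ### Residue fields as retracts -/

section ResidueField

variable {R : Type*} [CommRing R] {W : Type*} [AddCommGroup W] [Module R W]

/-- A nonzero module on which every scalar acts either as zero or bijectively has the residue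
field of a prime ideal as a direct summand. -/
lemma exists_residueField_retract [Nontrivial W]
    (hW : ∀ r : R, (∀ w : W, r • w = 0) ∨ Function.Bijective (fun w : W => r • w)) :
    ∃ (p : PrimeSpectrum R) (i : p.asIdeal.ResidueField →ₗ[R] W)
      (s : W →ₗ[R] p.asIdeal.ResidueField), s ∘ₗ i = LinearMap.id := by
  obtain ⟨w, hw⟩ := exists_ne (0 : W)
  have hbij : ∀ r ∉ Module.annihilator R W, Function.Bijective (fun w : W => r • w) :=
    fun r hr => (hW r).resolve_left fun h => hr (Module.mem_annihilator.2 h)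
  have hp : (Module.annihilator R W).IsPrime := by
    refine Ideal.isPrime_iff.2 ⟨fun h => ?_, fun {x y} hxy => ?_⟩
    · exact hw (by simpa using Module.mem_annihilator.1 ((Ideal.eq_top_iff_one _).1 h) w)
    · by_contra! hcon
      have := (hbij x hcon.1).1.comp (hbij y hcon.2).1
      refine hw (this ?_)
      simpa [mul_smul] using Module.mem_annihilator.1 hxy w
  -- The centre is commutative, so the universal property of the residue field applies; inverses of
  -- scalars stay central.
  let C := Subring.center (Module.End R W)
  let φ : R →+* C := (algebraMap R (Module.End R W)).codRestrict C fun r => by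
    rw [Subring.mem_center_iff]
    intro g
    exact (Algebra.commutes r g).symm
  have hφ : ∀ r (x : W), (φ r : Module.End R W) x = r • x := fun r x => rfl
  have hker : Module.annihilator R W ≤ RingHom.ker φ := by
    intro r hr
    rw [RingHom.mem_ker]
    ext x
    exact Module.mem_annihilator.1 hr x
  have hunit : (Module.annihilator R W).primeCompl ≤ (IsUnit.submonoid C).comap φ := by
    intro r hr
    have hb : Function.Bijective (φ r : Module.End R W) := hbij r hr
    let e := LinearEquiv.ofBijective (φ r : Module.End R W) hb
    have he : ∀ x, (φ r : Module.End R W) (e.symm x) = x := fun x => e.apply_symm_apply x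
    have hc : (e.symm : Module.End R W) ∈ C := by
      rw [Subring.mem_center_iff]
      intro g
      ext x
      apply hb.1
      change (φ r : Module.End R W) (g (e.symm x)) = (φ r : Module.End R W) (e.symm (g x))
      rw [he, hφ, ← map_smul, ← hφ, he]
    refine IsUnit.of_mul_eq_one (⟨_, hc⟩ : C) ?_
    ext x
    exact he x
  let ψ := Ideal.ResidueField.lift _ φ hker hunit
  let _ : Module (Module.annihilator R W).ResidueField W :=
    Module.compHom W (C.subtype.comp ψ)
  have hsmul : ∀ (a : (Module.annihilator R W).ResidueField) (x : W),
      a • x = (ψ a : Module.End R W) x := fun _ _ => rfl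
  have : IsScalarTower R (Module.annihilator R W).ResidueField W := by
    refine IsScalarTower.of_algebraMap_smul fun r x => ?_
    rw [hsmul, Ideal.ResidueField.lift_algebraMap, hφ]
  let i := LinearMap.toSpanSingleton (Module.annihilator R W).ResidueField W w
  obtain ⟨s, hs⟩ := i.exists_leftInverse_of_injective
    (LinearMap.ker_toSpanSingleton _ hw)
  refine ⟨⟨_, hp⟩, i.restrictScalars R, s.restrictScalars R, ?_⟩
  ext a
  exact LinearMap.congr_fun hs a

end ResidueField

/-! ### Simple objects by Zorn's lemma -/

variable {R : Type u} [CommRing R]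

lemma IsTorsionClass.sSup_mem {C : Set (ModuleCat.{u} R)} (hC : IsTorsionClass C)
    {X : Type u} [AddCommGroup X] [Module R X] {c : Set (Submodule R X)}
    (hc : ∀ U ∈ c, ModuleCat.of R U ∈ C) : ModuleCat.of R (sSup c : Submodule R X) ∈ C := by
  classical
  let f : (⨁ U : c, U.1) →ₗ[R] (sSup c : Submodule R X) :=
    DirectSum.toModule R c _ fun U => Submodule.inclusion (le_sSup U.2)
  refine hC.epi _ _ f ?_ (hC.directSum c (fun U => ModuleCat.of R U.1) fun U => hc _ U.2)
  have hle : sSup c ≤ LinearMap.range ((sSup c : Submodule R X).subtype ∘ₗ f) := by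
    refine sSup_le fun U hU x hx => ?_
    refine ⟨DirectSum.lof R c (fun U => U.1) ⟨U, hU⟩ ⟨x, hx⟩, ?_⟩
    simp [f]
  intro y
  obtain ⟨z, hz⟩ := hle y.2
  exact ⟨z, Subtype.ext hz⟩

variable {P Q : Type u} [AddCommGroup P] [Module R P] [AddCommGroup Q] [Module R Q]
  {σ : P →ₗ[R] Q}

lemma dClass_extension [Module.Projective R Q] {L M N : Type u} [AddCommGroup L] [Module R L]
    [AddCommGroup M] [Module R M] [AddCommGroup N] [Module R N]
    (f : L →ₗ[R] M) (g : M →ₗ[R] N) (hf : Function.Injective f) (hfg : Function.Exact f g)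
    (hg : Function.Surjective g)
    (hL : ModuleCat.of R L ∈ DClass σ) (hN : ModuleCat.of R N ∈ DClass σ) :
    ModuleCat.of R M ∈ DClass σ := by
  intro (k : P →ₗ[R] M)
  obtain ⟨(a : Q →ₗ[R] N), ha⟩ := hN (g ∘ₗ k)
  obtain ⟨b, hb⟩ := Module.projective_lifting_property g a hg
  have hmem : ∀ p, (k - b ∘ₗ σ) p ∈ LinearMap.range f := by
    intro p
    refine (hfg _).1 ?_
    have h1 : a (σ p) = g (k p) := LinearMap.congr_fun ha p
    have h2 : g (b (σ p)) = a (σ p) := LinearMap.congr_fun hb (σ p)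
    simp [h1, h2]
  let e := LinearEquiv.ofInjective f hf
  obtain ⟨(c : Q →ₗ[R] L), hc⟩ := hL (e.symm.toLinearMap ∘ₗ (k - b ∘ₗ σ).codRestrict _ hmem)
  refine ⟨b + f ∘ₗ c, ?_⟩
  ext p
  have h1 : c (σ p) = e.symm ((k - b ∘ₗ σ).codRestrict _ hmem p) := LinearMap.congr_fun hc p
  have h2 : f (c (σ p)) = k p - b (σ p) := by
    have := congrArg Subtype.val (congrArg e h1)
    simpa [e] using this
  change b (σ p) + f (c (σ p)) = k p
  rw [h2]
  abel

/-- The submodules of `X` lying in `D_σ`, when `Hom(σ, X)` is injective. -/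
lemma homBijective_of_mem_dClass {X : Type u} [AddCommGroup X] [Module R X]
    (hX : Function.Injective (fun g : Q →ₗ[R] X => g ∘ₗ σ)) {U : Submodule R X}
    (hU : ModuleCat.of R U ∈ DClass σ) : HomBijective σ U :=
  ⟨injective_comp_of_injective (Submodule.injective_subtype U) hX, hU⟩

/-- The modules `X` with `Hom(σ, X)` bijective are closed under quotients by submodules with the
same property. -/
lemma HomBijective.quotient [Module.Projective R Q] (hD : IsTorsionClass (DClass σ))
    {X : Type u} [AddCommGroup X] [Module R X] (hX : HomBijective σ X) {V : Submodule R X}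
    (hV : HomBijective σ V) : HomBijective σ (X ⧸ V) := by
  refine ⟨injective_comp_quotient hV.2 fun k hk q => ?_,
    hD.epi (ModuleCat.of R X) (ModuleCat.of R (X ⧸ V)) V.mkQ V.mkQ_surjective hX.2⟩
  have : k = 0 := hX.1 (hk.trans (LinearMap.zero_comp σ).symm)
  rw [this]
  exact V.zero_mem

/-- A nonzero module `X` with `Hom(σ, X)` bijective has a nonzero quotient of the same kind in
which the nonzero submodules in `D_σ` have a common nonzero element. -/
lemma HomBijective.exists_subdirectly_irreducible [Module.Projective R Q]
    (hD : IsTorsionClass (DClass σ)) {X : Type u} [AddCommGroup X] [Module R X] [Nontrivial X]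
    (hX : HomBijective σ X) :
    ∃ (V : Submodule R X) (y : X ⧸ V), HomBijective σ (X ⧸ V) ∧ y ≠ 0 ∧
      ∀ U : Submodule R (X ⧸ V), ModuleCat.of R U ∈ DClass σ → U ≠ ⊥ → y ∈ U := by
  obtain ⟨x, hx⟩ := exists_ne (0 : X)
  obtain ⟨V, -, hV⟩ := zorn_le_nonempty₀
    {V : Submodule R X | ModuleCat.of R V ∈ DClass σ ∧ x ∉ V}
    (fun c hc hchain U hU => ⟨sSup c, ⟨hD.sSup_mem fun W hW => (hc hW).1, fun hmem => by
      obtain ⟨W, hW, hxW⟩ := (Submodule.mem_sSup_of_directed ⟨U, hU⟩ hchain.directedOn).1 hmem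
      exact (hc hW).2 hxW⟩, fun W hW => le_sSup hW⟩)
    ⊥ ⟨fun g => ⟨(0 : Q →ₗ[R] (⊥ : Submodule R X)), LinearMap.ext fun p =>
      Subsingleton.elim (α := (⊥ : Submodule R X)) _ _⟩, fun h => hx ((Submodule.mem_bot R).1 h)⟩
  refine ⟨V, V.mkQ x,
    hX.quotient hD (homBijective_of_mem_dClass hX.1 hV.prop.1), fun h => ?_, fun U hU hU0 => ?_⟩
  · exact hV.prop.2 ((Submodule.Quotient.mk_eq_zero V).1 h)
  -- Otherwise the preimage of `U`, an extension of `U` by `V`, contradicts the maximality of `V`.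
  by_contra hxU
  have hVU : V ≤ U.comap V.mkQ := fun v hv => by
    rw [Submodule.mem_comap, Submodule.mkQ_apply, (Submodule.Quotient.mk_eq_zero V).2 hv]
    exact U.zero_mem
  have hmem : ModuleCat.of R (U.comap V.mkQ) ∈ DClass σ := by
    refine dClass_extension (L := V) (N := U) (Submodule.inclusion hVU)
      (V.mkQ.restrict (p := U.comap V.mkQ) (q := U) fun _ h => h)
      (Submodule.inclusion_injective hVU) ?_ ?_ hV.prop.1 hU
    · intro y
      constructor
      · intro h
        have h' : V.mkQ y.1 = 0 := congrArg Subtype.val h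
        exact ⟨⟨y.1, (Submodule.Quotient.mk_eq_zero V).1 h'⟩, rfl⟩
      · rintro ⟨v, rfl⟩
        exact Subtype.ext ((Submodule.Quotient.mk_eq_zero V).2 v.2)
    · rintro ⟨u, hu⟩
      obtain ⟨z, rfl⟩ := V.mkQ_surjective u
      exact ⟨⟨z, hu⟩, rfl⟩
  have hle : U.comap V.mkQ ≤ V := hV.le_of_ge ⟨hmem, hxU⟩ hVU
  refine hU0 ((Submodule.eq_bot_iff U).2 fun u hu => ?_)
  obtain ⟨z, rfl⟩ := V.mkQ_surjective u
  exact (Submodule.Quotient.mk_eq_zero V).2 (hle hu)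

/-- If there is a nonzero module `X` with `Hom(σ, X)` bijective, then there is one that is
simple among these. -/
lemma HomBijective.exists_simple [Module.Projective R Q]
    (hD : IsTorsionClass (DClass σ)) {X : Type u} [AddCommGroup X] [Module R X] [Nontrivial X]
    (hX : HomBijective σ X) :
    ∃ (Z : Type u) (_ : AddCommGroup Z) (_ : Module R Z), Nontrivial Z ∧ HomBijective σ Z ∧
      ∀ U : Submodule R Z, ModuleCat.of R U ∈ DClass σ → U = ⊥ ∨ U = ⊤ := by
  obtain ⟨V, y, hV, hy, hU⟩ := hX.exists_subdirectly_irreducible hD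
  -- All members contain `y`, so the infimum is nonzero.
  let c : Set (Submodule R (X ⧸ V)) := {U | ModuleCat.of R U ∈ DClass σ ∧ U ≠ ⊥}
  refine ⟨(sInf c : Submodule R (X ⧸ V)), inferInstance, inferInstance, ?_,
    hV.sInf_of_forall fun U hU => homBijective_of_mem_dClass hV.1 hU.1, fun U hUD => ?_⟩
  · refine ⟨⟨y, ?_⟩, 0, fun h => hy (congrArg Subtype.val h)⟩
    exact (Submodule.mem_sInf).2 fun U h => hU U h.1 h.2
  rw [or_iff_not_imp_left]
  intro hU0
  let e := Submodule.equivMapOfInjective (sInf c).subtype (Submodule.injective_subtype _) U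
  have hmem : U.map (sInf c).subtype ∈ c := by
    refine ⟨hD.epi (ModuleCat.of R U) (ModuleCat.of R (U.map (sInf c).subtype)) e.toLinearMap
      e.surjective hUD, fun h => hU0 ?_⟩
    exact Submodule.map_injective_of_injective (Submodule.injective_subtype _)
      (h.trans (Submodule.map_bot _).symm)
  rw [eq_top_iff]
  intro z _
  obtain ⟨z', hz', h⟩ := (sInf_le hmem : sInf c ≤ _) z.2
  rwa [← Subtype.ext h]

/-- Schur's lemma: kernel and image of a scalar lie in `D_σ`, so each is zero or everything. -/
lemma HomBijective.exists_residueField [Module.Projective R Q]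
    (hD : IsTorsionClass (DClass σ)) {X : Type u} [AddCommGroup X] [Module R X] [Nontrivial X]
    (hX : HomBijective σ X) :
    ∃ p : PrimeSpectrum R, HomBijective σ p.asIdeal.ResidueField := by
  obtain ⟨Z, _, _, _, hZ, hsimple⟩ := hX.exists_simple hD
  obtain ⟨p, i, s, h⟩ := exists_residueField_retract (R := R) (W := Z) fun r => by
    let m : Z →ₗ[R] Z := LinearMap.lsmul R Z r
    rcases hsimple _ (hZ.ker hZ.1 m).2 with hk | hk
    · rcases hsimple (LinearMap.range m) (hD.epi (ModuleCat.of R Z)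
        (ModuleCat.of R (LinearMap.range m)) m.rangeRestrict m.surjective_rangeRestrict hZ.2)
        with hr | hr
      · exact Or.inl fun w => LinearMap.congr_fun (LinearMap.range_eq_bot.1 hr) w
      · exact Or.inr ⟨LinearMap.ker_eq_bot.1 hk, LinearMap.range_eq_top.1 hr⟩
    · exact Or.inl fun w => LinearMap.congr_fun (LinearMap.ker_eq_top.1 hk) w
  exact ⟨p, hZ.of_retract i s h⟩

/-! ### `Gen(T)` and the trace -/

section Gen

variable {T : Type u} [AddCommGroup T] [Module R T]

lemma gen_epi {M N : ModuleCat.{u} R} (f : M →ₗ[R] N) (hf : Function.Surjective f)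
    (hM : M ∈ Gen (R := R) T) : N ∈ Gen (R := R) T := by
  obtain ⟨I, g, hg⟩ := hM
  exact ⟨I, f ∘ₗ g, hf.comp hg⟩

lemma gen_directSum (I : Type u) (M : I → ModuleCat.{u} R)
    (hM : ∀ i, M i ∈ Gen (R := R) T) : ModuleCat.of R (⨁ i, M i) ∈ Gen (R := R) T := by
  classical
  choose J f hf using hM
  let g : (⨁ _ : (Σ i, J i), T) →ₗ[R] ⨁ i, M i := DirectSum.toModule R _ _ fun x =>
    DirectSum.lof R I (fun i => M i) x.1 ∘ₗ f x.1 ∘ₗ DirectSum.lof R (J x.1) (fun _ => T) x.2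
  refine ⟨Σ i, J i, g, ?_⟩
  change Function.Surjective g
  rw [← LinearMap.range_eq_top, eq_top_iff]
  rintro z -
  induction z using DirectSum.induction_on with
  | zero => exact Submodule.zero_mem _
  | add x y hx hy => exact Submodule.add_mem _ hx hy
  | of i m =>
    obtain ⟨t, rfl⟩ := hf i m
    induction t using DirectSum.induction_on with
    | zero =>
      rw [map_zero, map_zero]
      exact Submodule.zero_mem _
    | add x y hx hy =>
      rw [map_add, map_add]
      exact Submodule.add_mem _ hx hy
    | of j t =>
      refine ⟨DirectSum.lof R _ (fun _ => T) ⟨i, j⟩ t, ?_⟩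
      simp only [g, DirectSum.toModule_lof]
      rfl

lemma self_mem_gen : ModuleCat.of R T ∈ Gen (R := R) T := by
  classical
  refine ⟨PUnit, DirectSum.toModule R _ _ fun _ => LinearMap.id, fun t => ?_⟩
  exact ⟨DirectSum.lof R PUnit (fun _ => T) ⟨⟩ t, DirectSum.toModule_lof R _ _⟩

open Classical in
/-- The trace of `T` in `M`. -/
noncomputable def trace (T M : Type u) [AddCommGroup T] [Module R T] [AddCommGroup M] [Module R M] :
    Submodule R M :=
  LinearMap.range (DirectSum.toModule R (T →ₗ[R] M) M fun f => f)

lemma trace_mem_gen (M : Type u) [AddCommGroup M] [Module R M] :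
    ModuleCat.of R (trace (R := R) T M) ∈ Gen (R := R) T :=
  ⟨T →ₗ[R] M, LinearMap.rangeRestrict _, LinearMap.surjective_rangeRestrict _⟩

lemma apply_mem_trace {M : Type u} [AddCommGroup M] [Module R M] (f : T →ₗ[R] M) (t : T) :
    f t ∈ trace (R := R) T M := by
  classical
  exact ⟨DirectSum.lof R (T →ₗ[R] M) (fun _ => T) f t, DirectSum.toModule_lof R _ _⟩

end Gen

/-! ### The two implications -/

lemma gen_subset_of_isTorsionClass {C : Set (ModuleCat.{u} R)} (hC : IsTorsionClass C)
    {T : Type u} [AddCommGroup T] [Module R T] (hT : ModuleCat.of R T ∈ C) :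
    Gen (R := R) T ⊆ C := by
  rintro M ⟨I, f, hf⟩
  exact hC.epi _ M f hf (hC.directSum I (fun _ => ModuleCat.of R T) fun _ => hT)

lemma IsTwoTermSilting.isPartialSilting [Module.Projective R Q]
    (h : IsTwoTermSilting σ) : IsPartialSilting σ := by
  have h' : DClass σ = Gen (R := R) (Coker σ) := h
  refine ⟨⟨fun M N f hf hM => ?_, fun L M N f g hf hfg hg hL hN => ?_, fun I M hM => ?_⟩, ?_⟩
  · rw [h'] at hM ⊢
    exact gen_epi f hf hM
  · exact dClass_extension f g hf hfg hg hL hN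
  · rw [h'] at hM ⊢
    exact gen_directSum I M hM
  · rw [h']
    exact self_mem_gen

lemma IsTwoTermSilting.nontrivial_or_ker_ne_bot (h : IsTwoTermSilting σ)
    (K : Type u) [Field K] [Algebra R K] :
    Nontrivial (Coker σ ⊗[R] K) ∨ LinearMap.ker (σ.rTensor K) ≠ ⊥ := by
  classical
  by_contra! hcon
  have hK : ModuleCat.of R K ∈ Gen (R := R) (Coker σ) := by
    rw [← show DClass σ = Gen (R := R) (Coker σ) from h]
    exact surjective_comp_of_ker_rTensor_eq_bot hcon.2
  obtain ⟨I, (f : (⨁ _ : I, Coker σ) →ₗ[R] K), hf⟩ := hK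
  have hf0 : f = 0 := by
    refine DirectSum.linearMap_ext R fun i => ?_
    rw [LinearMap.zero_comp]
    exact eq_zero_of_subsingleton_tensor hcon.1 _
  obtain ⟨z, hz⟩ := hf (1 : K)
  rw [hf0] at hz
  exact zero_ne_one hz

/-- If `σ` is partial silting and `M` lies in `D_σ`, then `Hom(σ, -)` is bijective at the quotient
of `M` by the trace of `Coker σ`. -/
lemma IsPartialSilting.homBijective_quotient_trace [Module.Projective R Q]
    (h : IsPartialSilting σ) {M : ModuleCat.{u} R} (hM : M ∈ DClass σ) :
    HomBijective σ (M ⧸ trace (R := R) (Coker σ) M) := by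
  refine ⟨injective_comp_quotient
    (gen_subset_of_isTorsionClass h.1 h.2 (trace_mem_gen M)) fun k hk q => ?_,
    h.1.epi M (ModuleCat.of R _) (Submodule.mkQ _) (Submodule.mkQ_surjective _) hM⟩
  -- A map killing the image of `σ` factors through `T`.
  exact apply_mem_trace ((LinearMap.range σ).liftQ k
    (LinearMap.range_le_ker_iff.2 hk)) (Submodule.Quotient.mk q)

end Silting

theorem mainTheorem5 {R : Type u} [CommRing R]
    {P Q : Type u} [AddCommGroup P] [Module R P] [Module.Projective R P]
    [AddCommGroup Q] [Module R Q] [Module.Projective R Q] (σ : P →ₗ[R] Q) :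
    Silting.IsTwoTermSilting σ ↔
      Silting.IsPartialSilting σ ∧
        ∀ p : PrimeSpectrum R,
          Nontrivial (Silting.Coker σ ⊗[R] p.asIdeal.ResidueField) ∨
            LinearMap.ker (σ.rTensor p.asIdeal.ResidueField) ≠ ⊥ := by
  refine ⟨fun h => ⟨h.isPartialSilting, fun p => h.nontrivial_or_ker_ne_bot _⟩, ?_⟩
  rintro ⟨h, hp⟩
  refine Set.Subset.antisymm (fun M hM => ?_) (Silting.gen_subset_of_isTorsionClass h.1 h.2)
  have hX := h.homBijective_quotient_trace hM
  have htop : Silting.trace (R := R) (Silting.Coker σ) M = ⊤ := by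
    rw [← Submodule.Quotient.subsingleton_iff, ← not_nontrivial_iff_subsingleton]
    intro
    obtain ⟨p, hpK⟩ := hX.exists_residueField h.1
    rcases hp p with hT | hker
    · exact not_nontrivial_iff_subsingleton.2 hpK.subsingleton_tensor hT
    · exact hker hpK.ker_rTensor_eq_bot
  exact ⟨_, _, LinearMap.range_eq_top.1 htop⟩
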